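/- A finite simple connected graph $G$ is called median if for all vertices $x,y,z$ the set $I(x,y)\cap I(y,z)\cap I(z,x)$ consists of exactly one vertex, where $I(u,v)=\{w : d(u,w)+d(w,v)=d(u,v)\}$ and $d$ is the graph distance. **Proposition.** The distance matrix $D(G)=(d(u,v))_{u,v\in V}$ of a median graph $G$ with $n$ vertices can be computed in $O(n^2)$ time, and this is optimal. Precisely, consider the unit-cost random-access machine with words of $O(\log n)$ bits, finitely many registers and finitely many arrays of words, whose instructions (assignments, additions, subtractions, multiplications, divisions with remainder, indirect loads and stores, and tests $<$ and $=$ that control branching and loops) take one step each. 1. There are a single program and a constant $C$ such that for every median graph $G$ with $n$ vertices $0,\dots,n-1$, given by adjacency lists in any order, the program halts after at most $Cn^2$ steps with $D(G)$ stored in its output array, initially zero, with $d(u,v)$ in cell $un+v$; all words used are bounded by a polynomial in $n$. 2. Conversely, any program that halts on such an input with $D(G)$ stored in the output array makes at least $n^2-n$ steps. -/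

import Mathlib

/-- The interval `I(u,v)`: all vertices on shortest `(u,v)`-paths. -/
def SimpleGraph.interval {V : Type*} (G : SimpleGraph V) (u v : V) : Set V :=
  {x | G.dist u x + G.dist x v = G.dist u v}

/-- A median graph: a connected graph in which `I(x,y) ∩ I(y,z) ∩ I(z,x)` is a singleton for
every triplet `x, y, z` of vertices. -/
def SimpleGraph.IsMedian {V : Type*} (G : SimpleGraph V) : Prop :=
  G.Connected ∧
    ∀ x y z : V, ∃! m : V, m ∈ G.interval x y ∩ G.interval y z ∩ G.interval z x

/-! Unit-cost random-access machine with bounded words. A program uses finitely many registers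
and finitely many random-access arrays of words (equivalently, up to a constant factor in the
running time, one memory in which the arrays are interleaved). -/
namespace RAM

/-- A memory configuration: the contents of register `r` is `reg r`, and the contents of cell
`i` of array `a` is `mem a i`. -/
@[ext]
structure State where
  reg : ℕ → ℕ
  mem : ℕ → ℕ → ℕ

/-- `s` with the value `x` written to register `r`. -/
def State.setReg (s : State) (r x : ℕ) : State :=
  { s with reg := Function.update s.reg r x }

/-- `s` with the value `x` written to cell `i` of array `a`. -/
def State.setMem (s : State) (a i x : ℕ) : State :=
  { s with mem := Function.update s.mem a (Function.update (s.mem a) i x) }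

/-- Every word of the configuration is at most `W`. -/
def State.Fits (s : State) (W : ℕ) : Prop :=
  (∀ r, s.reg r ≤ W) ∧ ∀ a i, s.mem a i ≤ W

/-- Arithmetic operations (subtraction is truncated; division and remainder are those of `ℕ`). -/
inductive BinOp where
  | add
  | sub
  | mul
  | div
  | mod

def BinOp.eval : BinOp → ℕ → ℕ → ℕ
  | .add, x, y => x + y
  | .sub, x, y => x - y
  | .mul, x, y => x * y
  | .div, x, y => x / y
  | .mod, x, y => x % y

/-- Tests compare the contents of two registers. -/
inductive Test where
  | lt (x y : ℕ)
  | eq (x y : ℕ)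

def Test.Holds : Test → State → Prop
  | .lt x y, s => s.reg x < s.reg y
  | .eq x y, s => s.reg x = s.reg y

/-- Programs. All arguments in `ℕ` are names of registers, except the constant `c` in `const`
and the array name `a` in `load` and `store`:
* `const r c` is `r := c`,
* `copy r x` is `r := x`,
* `op o r x y` is `r := x o y`,
* `load r a i` is `r := a[i]`,
* `store a i x` is `a[i] := x`. -/
inductive Prog where
  | skip
  | const (r c : ℕ)
  | copy (r x : ℕ)
  | op (o : BinOp) (r x y : ℕ)
  | load (r a i : ℕ)
  | store (a i x : ℕ)
  | seq (P Q : Prog)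
  | cond (b : Test) (P Q : Prog)
  | loop (b : Test) (P : Prog)

/-- `Exec W P s t s'`: on the machine whose words hold the numbers `0, …, W`, the program `P`
started in configuration `s` halts after exactly `t` steps in configuration `s'`. Every basic
instruction and every evaluation of a test is one step. There is no overflow: an instruction
whose result exceeds `W` cannot be executed. -/
inductive Exec (W : ℕ) : Prog → State → ℕ → State → Prop where
  | skip (s : State) : Exec W .skip s 0 s
  | const (s : State) (r c : ℕ) (h : c ≤ W) :
      Exec W (.const r c) s 1 (s.setReg r c)
  | copy (s : State) (r x : ℕ) :
      Exec W (.copy r x) s 1 (s.setReg r (s.reg x))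
  | op (s : State) (o : BinOp) (r x y : ℕ) (h : o.eval (s.reg x) (s.reg y) ≤ W) :
      Exec W (.op o r x y) s 1 (s.setReg r (o.eval (s.reg x) (s.reg y)))
  | load (s : State) (r a i : ℕ) :
      Exec W (.load r a i) s 1 (s.setReg r (s.mem a (s.reg i)))
  | store (s : State) (a i x : ℕ) :
      Exec W (.store a i x) s 1 (s.setMem a (s.reg i) (s.reg x))
  | seq {P Q : Prog} {s s' s'' : State} {t t' : ℕ}
      (hP : Exec W P s t s') (hQ : Exec W Q s' t' s'') :
      Exec W (.seq P Q) s (t + t') s''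
  | condTrue {b : Test} {P Q : Prog} {s s' : State} {t : ℕ}
      (hb : b.Holds s) (hP : Exec W P s t s') : Exec W (.cond b P Q) s (1 + t) s'
  | condFalse {b : Test} {P Q : Prog} {s s' : State} {t : ℕ}
      (hb : ¬ b.Holds s) (hQ : Exec W Q s t s') : Exec W (.cond b P Q) s (1 + t) s'
  | loopTrue {b : Test} {P : Prog} {s s' s'' : State} {t t' : ℕ}
      (hb : b.Holds s) (hP : Exec W P s t s') (hL : Exec W (.loop b P) s' t' s'') :
      Exec W (.loop b P) s (1 + t + t') s''
  | loopFalse {b : Test} {P : Prog} {s : State}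
      (hb : ¬ b.Holds s) : Exec W (.loop b P) s 1 s

/-- `adj v` lists the neighbours of `v`, each once, in an arbitrary order. -/
def IsAdjLists {n : ℕ} (G : SimpleGraph (Fin n)) (adj : Fin n → List (Fin n)) : Prop :=
  ∀ v, (adj v).Nodup ∧ ∀ u, u ∈ adj v ↔ G.Adj v u

/-- The input configuration for a graph on the vertices `0, …, n - 1` given by adjacency lists.
Register `0` contains `n`. Array `1` contains the concatenation of the adjacency lists of
`0, …, n - 1`; cell `k ≤ n` of array `0` contains the total length of the lists of
`0, …, k - 1`, so that the list of `v` occupies in array `1` the cells from the `v`-th up to, and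
excluding, the `(v + 1)`-st entry of array `0`. Everything else is `0`. -/
def inputState {n : ℕ} (adj : Fin n → List (Fin n)) : State where
  reg r := if r = 0 then n else 0
  mem a i :=
    if a = 0 then (if i ≤ n then (((List.ofFn adj).take i).flatten).length else 0)
    else if a = 1 then (((List.ofFn adj).flatten).map Fin.val).getD i 0
    else 0

/-- Array `2` contains the distance matrix of `G`, row by row. -/
def HoldsDistanceMatrix {n : ℕ} (G : SimpleGraph (Fin n)) (s : State) : Prop :=
  ∀ u v : Fin n, s.mem 2 ((u : ℕ) * n + (v : ℕ)) = G.dist u v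

end RAM

/-! Lower bound: the `n² - n` off-diagonal distances are positive, the output array starts at zero,
and one step changes at most one cell (`sq_le_add_of_exec`).

Upper bound: run a breadth-first search from a root `r` and add the vertices to the matrix in order
of their distance from `r`, keeping all distances within the set `S` of processed vertices. Let `v`
be the next vertex and `u` a member of `S`; every vertex closer to `r` than `v` lies in `S`. If `v`
has only one neighbour `p` closer to `r`, then `d(u,v) = d(u,p) + 1` (`dist_eq_dist_add_one`). If it
has two, `p` and `q`, the quadrangle condition gives them a common neighbour in `S`, and every such
`w` satisfies `d(u,v) = d(u,p) + d(u,q) - d(u,w)` (`dist_add_dist_of_square`). The square law rests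
on bipartiteness (`dist_succ_or`) and the absence of `K_{2,3}` (`not_three_common_adj`).

Finding `p` and `q`, finding `w` and filling the row and column of `v` take `O(n)` steps each.
Adjacency of processed vertices is read off the matrix as distance one. Every vertex is processed
once, and selecting the vertices of each level by a pass over all labels adds `O(n²)` in total. -/

namespace SimpleGraph

/-! ### Metric properties of median graphs -/

variable {V : Type*} {G : SimpleGraph V}

lemma dist_le_dist_add_one (hc : G.Connected) {x y : V} (h : G.Adj x y) (u : V) :
    G.dist u y ≤ G.dist u x + 1 := by
  have := hc.dist_triangle (u := u) (v := x) (w := y)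
  rwa [dist_eq_one_iff_adj.2 h] at this

/-- A vertex other than `m` has a neighbour on a shortest path to `m`. -/
lemma Connected.exists_adj_dist_succ (hc : G.Connected) {v m : V} (h : v ≠ m) :
    ∃ p, G.Adj v p ∧ G.dist p m + 1 = G.dist v m := by
  obtain ⟨w, hw⟩ := hc.exists_walk_length_eq_dist v m
  cases w with
  | nil => exact absurd rfl h
  | @cons _ p _ hp w =>
    refine ⟨p, hp, ?_⟩
    have h1 := dist_le w
    have h2 := dist_le_dist_add_one hc hp.symm m
    rw [Walk.length_cons] at hw
    rw [dist_comm (u := m), dist_comm (u := m)] at h2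
    omega

namespace IsMedian

/-- Median graphs are bipartite: the median of `x`, `y`, `u` lies in the interval of the edge `xy`,
so it is `x` or `y`, and that end lies between `u` and the other. -/
lemma dist_succ_or (hG : G.IsMedian) {x y : V} (h : G.Adj x y) (u : V) :
    G.dist u y = G.dist u x + 1 ∨ G.dist u x = G.dist u y + 1 := by
  obtain ⟨m, ⟨⟨h1, h2⟩, h3⟩, -⟩ := hG.2 x y u
  have hxy := dist_eq_one_iff_adj.2 h
  simp only [interval, Set.mem_ofPred_eq] at h1 h2 h3
  rw [hxy] at h1
  rcases Nat.eq_zero_or_pos (G.dist x m) with h0 | h0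
  · obtain rfl := (hG.1.dist_eq_zero_iff).1 h0
    left
    rw [dist_comm (u := y), hxy, dist_comm (u := x), dist_comm (u := y)] at h2
    omega
  · have : G.dist m y = 0 := by omega
    obtain rfl := (hG.1.dist_eq_zero_iff).1 this
    right
    rw [dist_comm (u := m) (v := x), hxy] at h3
    omega

/-- The witness is the median of `p`, `q`, `u`. By bipartiteness `p` and `q` are at distance two,
and they are equally far from `u`, so the median is adjacent to both and one step closer to `u`. -/
lemma quadrangle (hG : G.IsMedian) {u v p q : V} (hp : G.Adj v p) (hq : G.Adj v q) (hpq : p ≠ q)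
    (hup : G.dist u p + 1 = G.dist u v) (huq : G.dist u q + 1 = G.dist u v) :
    ∃ w, G.Adj p w ∧ G.Adj q w ∧ G.dist u w + 2 = G.dist u v := by
  obtain ⟨m, ⟨⟨h1, h2⟩, h3⟩, -⟩ := hG.2 p q u
  simp only [interval, Set.mem_ofPred_eq] at h1 h2 h3
  have h4 : G.dist p q ≤ 2 := by
    have := dist_le_dist_add_one hG.1 hq p
    rwa [dist_eq_one_iff_adj.2 hp.symm] at this
  have h5 : G.dist p q ≠ 0 := fun h => hpq (hG.1.dist_eq_zero_iff.1 h)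
  have h6 : G.dist p q ≠ 1 := fun h => by
    rcases hG.dist_succ_or (dist_eq_one_iff_adj.1 h) u with h | h <;> omega
  rw [dist_comm (u := m) (v := q)] at h1
  rw [dist_comm (u := m) (v := u), dist_comm (u := q) (v := u)] at h2
  rw [dist_comm (u := m) (v := p)] at h3
  exact ⟨m, dist_eq_one_iff_adj.1 (by omega), dist_eq_one_iff_adj.1 (by omega), by omega⟩

lemma dist_eq_two (hG : G.IsMedian) {p x y : V} (hx : G.Adj p x) (hy : G.Adj p y) (hxy : x ≠ y) :
    G.dist x y = 2 := by
  have h1 := dist_le_dist_add_one hG.1 hy x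
  rw [dist_eq_one_iff_adj.2 hx.symm] at h1
  have h2 : G.dist x y ≠ 0 := fun h => hxy (hG.1.dist_eq_zero_iff.1 h)
  have h3 : G.dist x y ≠ 1 := fun h => by
    have h4 := dist_eq_one_iff_adj.2 hx
    have h5 := dist_eq_one_iff_adj.2 hy
    rcases hG.dist_succ_or (dist_eq_one_iff_adj.1 h) p with h | h <;> omega
  omega

/-- A median graph contains no complete bipartite graph `K_{2,3}`. -/
lemma not_three_common_adj (hG : G.IsMedian) {p q x y z : V} (hpq : p ≠ q)
    (hxy : x ≠ y) (hyz : y ≠ z) (hzx : z ≠ x) (hpx : G.Adj p x) (hpy : G.Adj p y)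
    (hpz : G.Adj p z) (hqx : G.Adj q x) (hqy : G.Adj q y) (hqz : G.Adj q z) : False := by
  -- By `dist_eq_two` the vertices `x`, `y`, `z` are pairwise at distance two, so each common
  -- neighbour is a median of them.
  have key : ∀ r, G.Adj r x → G.Adj r y → G.Adj r z →
      r ∈ G.interval x y ∩ G.interval y z ∩ G.interval z x := by
    intro r h1 h2 h3
    simp only [interval, Set.mem_inter_iff, Set.mem_ofPred_eq, dist_eq_one_iff_adj.2 h1,
      dist_eq_one_iff_adj.2 h2, dist_eq_one_iff_adj.2 h3, dist_eq_one_iff_adj.2 h1.symm,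
      dist_eq_one_iff_adj.2 h2.symm, dist_eq_one_iff_adj.2 h3.symm, hG.dist_eq_two h1 h2 hxy,
      hG.dist_eq_two h2 h3 hyz, hG.dist_eq_two h3 h1 hzx, and_self]
  exact hpq ((hG.2 x y z).unique (key p hpx hpy hpz) (key q hqx hqy hqz))

/-- The distances to the opposite corners of a square have equal sums. -/
lemma dist_add_dist_of_square (hG : G.IsMedian) {v p w q : V} (hvw : v ≠ w) (hpq : p ≠ q)
    (hvp : G.Adj v p) (hvq : G.Adj v q) (hwp : G.Adj w p) (hwq : G.Adj w q) (u : V) :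
    G.dist u v + G.dist u w = G.dist u p + G.dist u q := by
  -- Along each edge the distance from `u` changes by one, so the sums can differ only if one pair
  -- of opposite corners is at a common distance and the other pair at that distance minus one. In
  -- that case the quadrangle condition yields a third common neighbour `m` of the lower pair, hence
  -- a `K_{2,3}`.
  have no : ∀ {a b c d : V}, a ≠ b → c ≠ d → G.Adj a c → G.Adj a d → G.Adj b c → G.Adj b d →
      ¬ (G.dist u c + 1 = G.dist u a ∧ G.dist u d + 1 = G.dist u a ∧
        G.dist u b = G.dist u a) := by
    rintro a b c d hab hcd hac had hbc hbd ⟨h1, h2, h3⟩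
    obtain ⟨m, hcm, hdm, hm⟩ := hG.quadrangle hac had hcd h1 h2
    refine hG.not_three_common_adj hcd hab (y := b) (z := m) ?_ ?_ hac.symm hbc.symm hcm had.symm
      hbd.symm hdm <;> rintro rfl <;> omega
  have h1 := hG.dist_succ_or hvp u
  have h2 := hG.dist_succ_or hvq u
  have h3 := hG.dist_succ_or hwp u
  have h4 := hG.dist_succ_or hwq u
  have h5 := no hvw hpq hvp hvq hwp hwq
  have h6 := no hpq hvw hvp.symm hwp.symm hvq.symm hwq.symm
  omega

/-- If `p` is the only neighbour of `v` that is closer to `r`, then `v` is a leaf, attached to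
`p`, in the metric on the vertices that are not farther from `r` than `v`. -/
lemma dist_eq_dist_add_one (hG : G.IsMedian) {r u v p : V}
    (hp : ∀ y, G.Adj v y → G.dist r y < G.dist r v → y = p)
    (hvp : G.Adj v p) (huv : u ≠ v) (hu : G.dist r u ≤ G.dist r v) :
    G.dist u v = G.dist u p + 1 := by
  -- The median `m` of `u`, `v`, `r` is not `v`, since otherwise `u` would be farther from `r` than
  -- `v`. The first step from `v` towards `m` leads closer to `r`, hence to `p`, and also closer to
  -- `u`.
  obtain ⟨m, ⟨⟨h1, h2⟩, h3⟩, -⟩ := hG.2 u v r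
  simp only [interval, Set.mem_ofPred_eq] at h1 h2 h3
  have hpos := hG.1.pos_dist_of_ne huv
  have hmv : v ≠ m := by
    rintro rfl
    rw [dist_comm (u := v) (v := u)] at h3
    omega
  obtain ⟨y, hvy, hy⟩ := hG.1.exists_adj_dist_succ hmv
  have h4 := hG.1.dist_triangle (u := y) (v := m) (w := r)
  have h5 := hG.1.dist_triangle (u := u) (v := m) (w := y)
  obtain rfl := hp y hvy (by
    rw [dist_comm (u := r), dist_comm (u := r)]
    omega)
  rw [dist_comm (u := m) (v := y)] at h5
  rw [dist_comm (u := m) (v := v)] at h1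
  have h6 := dist_le_dist_add_one hG.1 hvp.symm u
  omega

end IsMedian

end SimpleGraph

/-! ### Memory access and the lower bound -/

namespace RAM

@[simp] lemma State.setReg_reg (s : State) (r x r' : ℕ) :
    (s.setReg r x).reg r' = if r' = r then x else s.reg r' := by
  simp [State.setReg, Function.update_apply]

@[simp] lemma State.setReg_mem (s : State) (r x : ℕ) : (s.setReg r x).mem = s.mem := rfl

@[simp] lemma State.setMem_reg (s : State) (a i x : ℕ) : (s.setMem a i x).reg = s.reg := rfl

@[simp] lemma State.setMem_mem (s : State) (a i x a' i' : ℕ) :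
    (s.setMem a i x).mem a' i' = if a' = a ∧ i' = i then x else s.mem a' i' := by
  by_cases h : a' = a
  · subst h; simp [State.setMem, Function.update_apply]
  · simp [State.setMem, h]

/-- In `t` steps at most `t` cells of an array can become nonzero. -/
lemma Exec.card_filter_mem_ne_zero_le {W : ℕ} {P : Prog} {s s' : State} {t : ℕ}
    (h : Exec W P s t s') (a : ℕ) (F : Finset ℕ) :
    (F.filter fun i => s'.mem a i ≠ 0).card ≤ (F.filter fun i => s.mem a i ≠ 0).card + t := by
  induction h with
  | store s a' i x =>
    refine (Finset.card_le_card (t := insert (s.reg i) (F.filter fun j => s.mem a j ≠ 0))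
      fun j hj => ?_).trans (Finset.card_insert_le _ _)
    simp only [Finset.mem_filter, State.setMem_mem, Finset.mem_insert] at hj ⊢
    by_cases hji : j = s.reg i
    · exact Or.inl hji
    · simpa [hji] using hj
  | skip | const | copy | op | load => exact Nat.le_add_right _ _
  | _ => omega

lemma cell_inj {n a b c d : ℕ} (hb : b < n) (hd : d < n) :
    a * n + b = c * n + d ↔ a = c ∧ b = d := by
  refine ⟨fun h => ?_, fun ⟨h1, h2⟩ => h1 ▸ h2 ▸ rfl⟩
  have hn : 0 < n := by omega
  have h1 := congrArg (· / n) h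
  have h2 := congrArg (· % n) h
  simp only [Nat.add_div_of_dvd_right (Dvd.intro_left _ rfl), Nat.mul_div_cancel _ hn,
    Nat.div_eq_of_lt hb, Nat.div_eq_of_lt hd, Nat.mul_add_mod', Nat.mod_eq_of_lt hb,
    Nat.mod_eq_of_lt hd, add_zero] at h1 h2
  exact ⟨h1, h2⟩

/-- The bounds are not strict because `n` encodes a missing neighbour, and the program may form an
address from it. -/
lemma cell_le {n a b : ℕ} (ha : a ≤ n) (hb : b ≤ n) : a * n + b ≤ 2 * n ^ 2 := by
  nlinarith [Nat.mul_le_mul_right n ha, Nat.le_self_pow two_ne_zero n]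

lemma sq_le_add_of_exec {n W t : ℕ} {P : Prog} {G : SimpleGraph (Fin n)} (hG : G.Connected)
    {adj : Fin n → List (Fin n)} {s : State} (h : Exec W P (inputState adj) t s)
    (hs : HoldsDistanceMatrix G s) : n ^ 2 ≤ t + n := by
  classical
  let f : Fin n × Fin n → ℕ := fun x => x.1 * n + x.2
  have hf : Function.Injective f := fun x y hxy => by
    have := (cell_inj x.2.2 y.2.2).1 hxy
    exact Prod.ext (Fin.ext this.1) (Fin.ext this.2)
  -- These are the off-diagonal cells: all zero at the start, all nonzero at the end.
  let F : Finset ℕ := (Finset.univ : Finset (Fin n)).offDiag.image f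
  have hF : F.card = n * n - n := by
    rw [Finset.card_image_of_injective _ hf, Finset.offDiag_card, Finset.card_univ,
      Fintype.card_fin]
  have h1 := h.card_filter_mem_ne_zero_le 2 F
  rw [Finset.filter_true_of_mem, Finset.filter_false_of_mem, hF, Finset.card_empty] at h1
  · rw [sq]
    omega
  · simp [inputState]
  · intro i hi
    obtain ⟨⟨u, v⟩, huv, rfl⟩ := Finset.mem_image.1 hi
    rw [show s.mem 2 (f (u, v)) = G.dist u v from hs u v]
    exact (hG.pos_dist_of_ne (Finset.mem_offDiag.1 huv).2.2).ne'

/-- Started in `s`, the program `P` halts after at most `T` steps in a configuration that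
satisfies `Q`. -/
def Runs (W : ℕ) (P : Prog) (s : State) (T : ℕ) (Q : State → Prop) : Prop :=
  ∃ t s', Exec W P s t s' ∧ t ≤ T ∧ Q s'

/-- The programs of a list, executed one after the other. -/
def block : List Prog → Prog
  | [] => .skip
  | P :: L => .seq P (block L)

variable {W : ℕ} {s : State} {T T' : ℕ} {Q : State → Prop} {P P' : Prog} {L : List Prog}

/-! ### Proof rules for programs with a time bound -/

namespace Runs

lemma mono {Q' : State → Prop} (h : Runs W P s T Q) (hT : T ≤ T') (hQ : ∀ s, Q s → Q' s) :
    Runs W P s T' Q' := by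
  obtain ⟨t, s', h1, h2, h3⟩ := h
  exact ⟨t, s', h1, h2.trans hT, hQ _ h3⟩

lemma nil (h : Q s) : Runs W (block []) s T Q := ⟨0, s, .skip s, zero_le, h⟩

lemma skip (h : Q s) : Runs W .skip s T Q := ⟨0, s, .skip s, zero_le, h⟩

/-- The postcondition of the first program is the run of the rest, so a block is verified by
executing it symbolically from the front. -/
lemma cons (h : Runs W P s T fun s' => Runs W (block L) s' T' Q) :
    Runs W (block (P :: L)) s (T' + T) Q := by
  obtain ⟨t, s', h1, h2, t', s'', h3, h4, h5⟩ := h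
  exact ⟨t + t', s'', .seq h1 h3, by omega, h5⟩

lemma last (h : Runs W P s T Q) : Runs W (block [P]) s T Q := by
  obtain ⟨t, s', h1, h2, h3⟩ := h
  exact ⟨t + 0, s', .seq h1 (.skip _), h2, h3⟩

lemma const {r c : ℕ} (hc : c ≤ W) (h : Runs W (block L) (s.setReg r c) T Q) :
    Runs W (block (.const r c :: L)) s (T + 1) Q :=
  cons ⟨1, _, .const s r c hc, le_rfl, h⟩

lemma copy {r x : ℕ} (h : Runs W (block L) (s.setReg r (s.reg x)) T Q) :
    Runs W (block (.copy r x :: L)) s (T + 1) Q :=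
  cons ⟨1, _, .copy s r x, le_rfl, h⟩

/-- The result `z` is supplied in simplified form, so that the overflow condition and the new state
mention it and not the registers. -/
lemma op {o : BinOp} {r x y : ℕ} (z : ℕ) (hz : o.eval (s.reg x) (s.reg y) = z) (hc : z ≤ W)
    (h : Runs W (block L) (s.setReg r z) T Q) :
    Runs W (block (.op o r x y :: L)) s (T + 1) Q := by
  subst hz
  exact cons ⟨1, _, .op s o r x y hc, le_rfl, h⟩

lemma load {r a i : ℕ} (h : Runs W (block L) (s.setReg r (s.mem a (s.reg i))) T Q) :
    Runs W (block (.load r a i :: L)) s (T + 1) Q :=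
  cons ⟨1, _, .load s r a i, le_rfl, h⟩

lemma store {a i x : ℕ} (h : Runs W (block L) (s.setMem a (s.reg i) (s.reg x)) T Q) :
    Runs W (block (.store a i x :: L)) s (T + 1) Q :=
  cons ⟨1, _, .store s a i x, le_rfl, h⟩

lemma cond {b : Test} (h : b.Holds s → Runs W P s T Q) (h' : ¬ b.Holds s → Runs W P' s T Q) :
    Runs W (.cond b P P') s (T + 1) Q := by
  by_cases hb : b.Holds s
  · obtain ⟨t, s', h1, h2, h3⟩ := h hb
    exact ⟨1 + t, s', .condTrue hb h1, by omega, h3⟩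
  · obtain ⟨t, s', h1, h2, h3⟩ := h' hb
    exact ⟨1 + t, s', .condFalse hb h1, by omega, h3⟩

/-- A loop with invariant `I j` after `j` rounds that makes `N` rounds. -/
lemma loop {b : Test} (I : ℕ → State → Prop) (N : ℕ) (cost : ℕ → ℕ)
    (hstep : ∀ j < N, ∀ s, I j s → b.Holds s ∧ Runs W P s (cost j) (I (j + 1)))
    (hend : ∀ s, I N s → ¬ b.Holds s) (h0 : I 0 s) :
    Runs W (.loop b P) s (∑ j ∈ Finset.range N, (cost j + 1) + 1) (I N) := by
  -- Induction on the number `m` of rounds that remain.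
  suffices H : ∀ m ≤ N, ∀ s, I (N - m) s →
      Runs W (.loop b P) s (∑ j ∈ Finset.Ico (N - m) N, (cost j + 1) + 1) (I N) by
    simpa using H N le_rfl s (by simpa using h0)
  intro m
  induction m with
  | zero =>
    intro _ s hs
    exact ⟨1, s, .loopFalse (hend s hs), by simp, hs⟩
  | succ m ih =>
    intro hm s hs
    obtain ⟨hb, t, s', h1, h2, h3⟩ := hstep _ (by omega) s hs
    have e : N - (m + 1) + 1 = N - m := by omega
    rw [e] at h3
    obtain ⟨t', s'', h4, h5, h6⟩ := ih (by omega) s' h3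
    refine ⟨1 + t + t', s'', .loopTrue hb h1 h4, ?_, h6⟩
    rw [Finset.sum_eq_sum_Ico_succ_bot (by omega), e]
    omega

lemma loop_const {b : Test} (I : ℕ → State → Prop) (N c : ℕ)
    (hstep : ∀ j < N, ∀ s, I j s → b.Holds s ∧ Runs W P s c (I (j + 1)))
    (hend : ∀ s, I N s → ¬ b.Holds s) (h0 : I 0 s) :
    Runs W (.loop b P) s (N * (c + 1) + 1) (I N) := by
  simpa using loop I N (fun _ => c) hstep hend h0

end Runs

end RAM

/-- A shortest path repeats no vertex. The bound keeps distances within a word and shows that `n`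
levels exhaust the graph. -/
lemma SimpleGraph.Connected.dist_lt {n : ℕ} {G : SimpleGraph (Fin n)} (hG : G.Connected)
    (u v : Fin n) : G.dist u v < n := by
  obtain ⟨w, hw, h⟩ := hG.exists_path_of_dist u v
  simpa [h] using hw.length_lt

namespace RAM

/-! ### The program

Array `3` contains the label of a vertex, its distance from the vertex `0` plus `1`, or `0` if it
has not been seen; array `4` marks the processed vertices. Registers: `1` is the level `k`, `2` is
`k + 1`, `3` is the current vertex, `6` and `7` are its lower neighbours `p` and `q`
(`n` if missing), `8` is the other common neighbour of `p` and `q`. -/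

/-- Register `11` holds `0`, the label of an unseen vertex, and `15` holds `k + 2`, the label of
level `k + 1`. A nonzero label below `k + 1` marks a lower neighbour, which is shifted into the pair
`(p, q)`. -/
def scanBody : Prog :=
  block [.load 16 1 4, .load 12 3 16,
    .cond (.eq 12 11) (block [.store 3 16 15])
      (.cond (.lt 12 2) (block [.copy 7 6, .copy 6 16]) .skip),
    .op .add 4 4 10]

/-- Adjacency to `p` and `q` is tested as a matrix entry equal to `1`, which is meaningful because
only processed vertices are examined. -/
def searchBody : Prog :=
  block [.load 12 4 9,
    .cond (.eq 12 10)
      (block [.op .mul 14 6 0, .op .add 14 14 9, .load 12 2 14,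
        .cond (.eq 12 10)
          (block [.op .mul 14 7 0, .op .add 14 14 9, .load 12 2 14,
            .cond (.eq 12 10) (block [.copy 8 9]) .skip])
          .skip])
      .skip,
    .op .add 9 9 10]

/-- The test `q < n` distinguishes two lower neighbours from one. The sum is formed before the
truncated subtraction. -/
def fillBody : Prog :=
  block [.load 12 4 9,
    .cond (.eq 12 10)
      (block [.op .mul 14 6 0, .op .add 14 14 9, .load 12 2 14,
        .cond (.lt 7 0)
          (block [.op .mul 14 7 0, .op .add 14 14 9, .load 13 2 14, .op .add 12 12 13,
            .op .mul 14 8 0, .op .add 14 14 9, .load 13 2 14, .op .sub 12 12 13])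
          (block [.op .add 12 12 10]),
        .op .mul 14 3 0, .op .add 14 14 9, .store 2 14 12,
        .op .mul 14 9 0, .op .add 14 14 3, .store 2 14 12])
      .skip,
    .op .add 9 9 10]

def scan : Prog :=
  block [.load 4 0 3, .op .add 16 3 10, .load 5 0 16, .copy 6 0, .copy 7 0, .op .add 15 2 10,
    .loop (.lt 4 5) scanBody]

def search : Prog := block [.const 9 0, .loop (.lt 9 0) searchBody]

def fill : Prog := block [.const 9 0, .loop (.lt 9 0) fillBody]

def process : Prog := block [scan, search, fill, .store 4 3 10]

def vertexBody : Prog :=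
  block [.load 12 3 3, .cond (.eq 12 2) process .skip, .op .add 3 3 10]

def levelBody : Prog :=
  block [.op .add 2 1 10, .const 3 0, .loop (.lt 3 0) vertexBody, .op .add 1 1 10]

def distanceProg : Prog :=
  block [.const 10 1, .store 3 11 10, .loop (.lt 1 0) levelBody]

/-! ### Invariants -/

/-- The registers that control the loops over levels and vertices. -/
structure Ctx (n k v : ℕ) (reg : ℕ → ℕ) : Prop where
  n : reg 0 = n
  level : reg 1 = k
  label : reg 2 = k + 1
  vertex : reg 3 = v
  one : reg 10 = 1
  zero : reg 11 = 0

lemma Ctx.setReg {n k v r x : ℕ} {s : State} (h : Ctx n k v s.reg)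
    (hr : r ∉ [0, 1, 2, 3, 10, 11]) : Ctx n k v (s.setReg r x).reg := by
  simp only [List.mem_cons, List.not_mem_nil, or_false, not_or] at hr
  obtain ⟨h1, h2, h3, h4, h5, h6⟩ := h
  constructor <;> rw [State.setReg_reg, if_neg (by omega)] <;> assumption

variable {n : ℕ} {G : SimpleGraph (Fin n)} {adj : Fin n → List (Fin n)} {r : Fin n}
  {U S : Set (Fin n)} {mem : ℕ → ℕ → ℕ}

open Classical in
/-- The memory when the vertices in `U` have been labelled and those in `S` processed. -/
structure MemInv (G : SimpleGraph (Fin n)) (adj : Fin n → List (Fin n)) (r : Fin n)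
    (U S : Set (Fin n)) (mem : ℕ → ℕ → ℕ) : Prop where
  offset : ∀ i, mem 0 i = (inputState adj).mem 0 i
  nbr : ∀ i, mem 1 i = (inputState adj).mem 1 i
  label : ∀ x : Fin n, mem 3 x = if x ∈ U then G.dist r x + 1 else 0
  mark : ∀ x : Fin n, mem 4 x = if x ∈ S then 1 else 0
  known : ∀ x ∈ S, ∀ y ∈ S, mem 2 (x * n + y) = G.dist x y
  diag : ∀ x : Fin n, mem 2 (x * n + x) = 0

/-- `p` and `q` are the last two of the elements that satisfy `C`, and `n` if there are none. -/
def LastTwo {n : ℕ} (C : Fin n → Prop) (p q : ℕ) : Prop :=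
  (p = n ∧ q = n ∧ ∀ y, ¬ C y) ∨
  (∃ a, C a ∧ p = a ∧ q = n ∧ ∀ y, C y → y = a) ∨
  ∃ a b, a ≠ b ∧ C a ∧ C b ∧ p = a ∧ q = b

lemma LastTwo.le {C : Fin n → Prop} {p q : ℕ} (h : LastTwo C p q) : p ≤ n ∧ q ≤ n := by
  rcases h with ⟨rfl, rfl, -⟩ | ⟨a, -, rfl, rfl, -⟩ | ⟨a, b, -, -, -, rfl, rfl⟩ <;> omega

lemma LastTwo.congr {C C' : Fin n → Prop} {p q : ℕ} (h : LastTwo C p q) (hC : ∀ x, C' x ↔ C x) :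
    LastTwo C' p q := by
  rwa [show C' = C from funext fun x => propext (hC x)]

/-- Shifting the pair preserves the property: the old `p` becomes the second entry, and it is `n`
exactly when `y` is the first element found. -/
lemma LastTwo.snoc {C C' : Fin n → Prop} {p q : ℕ} (h : LastTwo C p q) {y : Fin n}
    (hy : ¬ C y) (hC : ∀ x, C' x ↔ C x ∨ x = y) : LastTwo C' y p := by
  rcases h with ⟨rfl, rfl, h⟩ | ⟨a, ha, rfl, rfl, h⟩ | ⟨a, b, hab, ha, hb, rfl, rfl⟩
  · exact Or.inr (Or.inl ⟨y, (hC y).2 (Or.inr rfl), rfl, rfl,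
      fun x hx => ((hC x).1 hx).resolve_left (h x)⟩)
  all_goals
    exact Or.inr (Or.inr ⟨y, a, fun h => hy (h ▸ ha), (hC y).2 (Or.inr rfl),
      (hC a).2 (Or.inl ha), rfl, rfl⟩)

/-! ### The input -/

lemma length_flatten_take_le (hadj : IsAdjLists G adj) (i : ℕ) :
    (((List.ofFn adj).take i).flatten).length ≤ n * n := by
  have h1 : (((List.ofFn adj).take i).flatten).length ≤ (List.ofFn adj).flatten.length :=
    ((List.take_sublist _ _).flatten).length_le
  refine h1.trans ?_
  rw [List.length_flatten, List.map_ofFn, List.sum_ofFn]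
  refine (Finset.sum_le_card_nsmul _ _ n fun v _ => ?_).trans (by simp)
  simpa using (hadj v).1.length_le_card

lemma length_adj_le (hadj : IsAdjLists G adj) (v : Fin n) : (adj v).length ≤ n := by
  simpa using (hadj v).1.length_le_card

lemma fits_inputState (hadj : IsAdjLists G adj) {W : ℕ} (hW : 4 * n ^ 2 ≤ W) :
    (inputState adj).Fits W := by
  have hn := Nat.le_self_pow two_ne_zero n
  refine ⟨fun x => ?_, fun a i => ?_⟩
  · simp only [inputState]
    split_ifs <;> omega
  · simp only [inputState]
    split_ifs
    · exact (length_flatten_take_le hadj i).trans (by rw [← sq]; omega)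
    · omega
    · rw [List.getD_eq_getElem?_getD]
      rcases h : ((List.ofFn adj).flatten.map Fin.val)[i]? with - | x
      · simp
      · obtain ⟨y, -, rfl⟩ := List.mem_map.1 (List.mem_of_getElem? h)
        have := y.2
        simp only [Option.getD_some]
        omega
    · omega

lemma inputState_offset_succ (v : Fin n) :
    (inputState adj).mem 0 (v + 1) = (inputState adj).mem 0 v + (adj v).length := by
  have h1 : (v : ℕ) + 1 ≤ n := v.2
  have h2 : (v : ℕ) ≤ n := v.2.le
  simp [inputState, h1, h2]

lemma inputState_nbr (v : Fin n) {j : ℕ} (hj : j < (adj v).length) :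
    (inputState adj).mem 1 ((inputState adj).mem 0 v + j) = (adj v)[j] := by
  have h : (v : ℕ) < (List.ofFn adj).length := by simp
  have h2 : (v : ℕ) ≤ n := v.2.le
  have e : (List.ofFn adj).flatten = ((List.ofFn adj).take v).flatten ++
      (adj v ++ ((List.ofFn adj).drop (v + 1)).flatten) := by
    conv_lhs => rw [← List.take_append_drop v (List.ofFn adj), List.drop_eq_getElem_cons h]
    simp
  simp only [inputState, h2, if_true, one_ne_zero, if_false]
  rw [e, List.getD_eq_getElem?_getD, List.getElem?_map, List.getElem?_append_right (by omega),
    Nat.add_sub_cancel_left, List.getElem?_append_left hj, List.getElem?_eq_getElem hj]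
  rfl

end RAM

/-! ### Scanning an adjacency list: labels and lower neighbours -/

namespace RAM

variable {n : ℕ} {G : SimpleGraph (Fin n)} {adj : Fin n → List (Fin n)} {r : Fin n}
  {U S : Set (Fin n)} {W k : ℕ} {s : State}

/-- The root and the neighbours of processed vertices. -/
def labelled (G : SimpleGraph (Fin n)) (r : Fin n) (S : Set (Fin n)) : Set (Fin n) :=
  {x | x = r ∨ ∃ y ∈ S, G.Adj y x}

lemma MemInv.add_label (h : MemInv G adj r U S s.mem) (y : Fin n) {c : ℕ}
    (hc : c = G.dist r y + 1) : MemInv G adj r (insert y U) S (s.setMem 3 y c).mem := by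
  refine ⟨fun i => ?_, fun i => ?_, fun x => ?_, fun x => ?_, fun x hx z hz => ?_, fun x => ?_⟩
  · simpa using h.offset i
  · simpa using h.nbr i
  · have := h.label x
    by_cases hxy : x = y
    · subst hxy; simp [hc]
    · have e : x ∈ insert y U ↔ x ∈ U := Set.mem_insert_iff.trans (or_iff_right hxy)
      rw [State.setMem_mem, if_neg fun h => hxy (Fin.ext h.2), this]
      by_cases hx : x ∈ U
      · rw [if_pos hx, if_pos (e.2 hx)]
      · rw [if_neg hx, if_neg (hx ∘ e.1)]
  · simpa using h.mark x
  · simpa using h.known x hx z hz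
  · simpa using h.diag x

lemma scanBody_spec (hG : G.IsMedian) (hadj : IsAdjLists G adj) (hW : 4 * n ^ 2 ≤ W) {v : Fin n}
    (hk : G.dist r v = k) (hlow : ∀ x, G.dist r x < k → x ∈ S) {j : ℕ} (hj : j < (adj v).length)
    (hc : Ctx n k v s.reg)
    (hm : MemInv G adj r (labelled G r S ∪ {x | x ∈ (adj v).take j}) S s.mem)
    (hl : LastTwo (fun x => x ∈ (adj v).take j ∧ G.dist r x < k) (s.reg 6) (s.reg 7))
    (h4 : s.reg 4 = (inputState adj).mem 0 v + j)
    (h5 : s.reg 5 = (inputState adj).mem 0 v + (adj v).length) (h15 : s.reg 15 = k + 2) :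
    Runs W scanBody s 7 fun s' => Ctx n k v s'.reg ∧
      MemInv G adj r (labelled G r S ∪ {x | x ∈ (adj v).take (j + 1)}) S s'.mem ∧
      LastTwo (fun x => x ∈ (adj v).take (j + 1) ∧ G.dist r x < k) (s'.reg 6) (s'.reg 7) ∧
      s'.reg 4 = (inputState adj).mem 0 v + (j + 1) ∧
      s'.reg 5 = (inputState adj).mem 0 v + (adj v).length ∧ s'.reg 15 = k + 2 := by
  set y := (adj v)[j] with hy
  have htake : ∀ x, x ∈ (adj v).take (j + 1) ↔ x ∈ (adj v).take j ∨ x = y := by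
    intro x
    rw [List.take_succ_eq_append_getElem hj, List.mem_append, List.mem_singleton]
  have hU : labelled G r S ∪ {x | x ∈ (adj v).take (j + 1)} =
      insert y (labelled G r S ∪ {x | x ∈ (adj v).take j}) := by
    ext x
    simp only [Set.mem_union, Set.mem_insert_iff, Set.mem_ofPred_eq, htake]
    tauto
  have hynot : y ∉ (adj v).take j := by
    intro hmem
    obtain ⟨i, hi, e⟩ := List.getElem_of_mem hmem
    rw [List.getElem_take] at e
    have := (List.Nodup.getElem_inj_iff (hadj v).1).1 e
    rw [List.length_take] at hi
    omega
  have hvy : G.Adj v y := ((hadj v).2 y).1 (List.getElem_mem hj)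
  have hyk := hG.dist_succ_or hvy r
  rw [hk] at hyk
  -- If an unlabelled `y` were below level `k`, its own neighbour closer to the root would already
  -- be processed and would have labelled it. By bipartiteness `y` is then on level `k + 1`.
  have hlabel : y ∉ labelled G r S → G.dist r y = k + 1 := by
    intro hyU
    by_contra hne
    refine hyU ?_
    by_cases hyr : y = r
    · exact Or.inl hyr
    · obtain ⟨z, hz, hd⟩ := hG.1.exists_adj_dist_succ hyr
      rw [SimpleGraph.dist_comm, SimpleGraph.dist_comm (u := y)] at hd
      exact Or.inr ⟨z, hlow z (by omega), hz.symm⟩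
  have hnb : s.mem 1 (s.reg 4) = y := by rw [hm.nbr, h4, inputState_nbr v hj]
  have hly := hm.label y
  -- The advanced pointer does not pass the end of the list of `v`, whose position is itself a word
  -- of the input.
  have hoff : (inputState adj).mem 0 v + (j + 1) ≤ W := by
    have h1 := (fits_inputState hadj hW).2 0 (v + 1)
    rw [inputState_offset_succ] at h1
    omega
  rw [hU]
  have hlast : LastTwo (fun x => x ∈ (adj v).take j ∧ G.dist r x < k) (s.reg 6) (s.reg 7) →
      ¬ G.dist r y < k →
      LastTwo (fun x => x ∈ (adj v).take (j + 1) ∧ G.dist r x < k) (s.reg 6) (s.reg 7) := by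
    intro hl hyk
    refine hl.congr fun x => ?_
    rw [htake]
    constructor
    · rintro ⟨h | h, h'⟩
      · exact ⟨h, h'⟩
      · exact absurd (h ▸ h') hyk
    · exact fun h => ⟨Or.inl h.1, h.2⟩
  -- The conditional is treated from an abstract state, so that its three branches share the
  -- instructions before and after it.
  suffices H : ∀ s1 : State, s1.mem = s.mem → s1.reg 4 = s.reg 4 → s1.reg 5 = s.reg 5 →
      s1.reg 6 = s.reg 6 → s1.reg 7 = s.reg 7 → s1.reg 15 = s.reg 15 → s1.reg 16 = y →
      s1.reg 12 = s.mem 3 y → Ctx n k v s1.reg → Runs W (.cond (.eq 12 11)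
        (block [.store 3 16 15]) (.cond (.lt 12 2) (block [.copy 7 6, .copy 6 16]) .skip)) s1 4
        fun s' => Ctx n k v s'.reg ∧
          MemInv G adj r (insert y (labelled G r S ∪ {x | x ∈ (adj v).take j})) S s'.mem ∧
          LastTwo (fun x => x ∈ (adj v).take (j + 1) ∧ G.dist r x < k) (s'.reg 6) (s'.reg 7) ∧
          s'.reg 4 = (inputState adj).mem 0 v + j ∧
          s'.reg 5 = (inputState adj).mem 0 v + (adj v).length ∧ s'.reg 15 = k + 2 by
    refine .load (.load (.cons ((H _ (by exact rfl) (by simp) (by simp) (by simp) (by simp) (by simp)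
      (by simp [hnb]) (by simp [hnb])
      (by exact (hc.setReg (by simp)).setReg (by simp))).mono le_rfl ?_)))
    rintro s' ⟨hc', hm', hl', h4', h5', h15'⟩
    refine .op ((inputState adj).mem 0 v + (j + 1)) ?_ hoff
      (.nil (T := 0) ⟨hc'.setReg (by simp), hm', ?_, ?_, ?_, ?_⟩)
    · rw [h4', hc'.one]
      rfl
    · simpa using hl'
    · simp
    · simpa using h5'
    · simpa using h15'
  intro s1 e e4 e5 e6 e7 e15 e16 e12 hc1
  rw [← e] at hm
  rw [h4] at e4
  rw [h5] at e5
  rw [h15] at e15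
  refine .cond (fun hb => ?_) fun hb => .cond (T := 2) (fun hb' => ?_) fun hb' => ?_
  · rw [Test.Holds, e12, hc1.zero, hly] at hb
    have hyU : y ∉ labelled G r S ∪ {x | x ∈ (adj v).take j} := by
      intro h
      rw [if_pos h] at hb
      omega
    have hy1 := hlabel fun h => hyU (Or.inl h)
    refine .store (T := 2) (.nil ⟨hc1, ?_, ?_, e4, e5, e15⟩)
    · rw [e16]
      exact MemInv.add_label hm y (by rw [e15, hy1])
    · rw [State.setMem_reg, e6, e7]
      exact hlast hl (by omega)
  all_goals
    rw [Test.Holds, e12, hc1.zero, hly] at hb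
    rw [Test.Holds, e12, hc1.label, hly] at hb'
    have hyU : y ∈ labelled G r S ∪ {x | x ∈ (adj v).take j} := by
      by_contra h
      exact hb (if_neg h)
    rw [if_pos hyU, Nat.add_lt_add_iff_right] at hb'
    rw [Set.insert_eq_of_mem hyU]
  · refine .copy (.copy (.nil (T := 0) ⟨(hc1.setReg (by simp)).setReg (by simp), hm, ?_,
      by simpa using e4, by simpa using e5, by simpa using e15⟩))
    simp only [State.setReg_reg, e6, e7, e16]
    refine hl.snoc (fun h => hynot h.1) fun x => ?_
    rw [htake]
    constructor
    · rintro ⟨h | h, h'⟩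
      · exact Or.inl ⟨h, h'⟩
      · exact Or.inr h
    · rintro (h | h)
      · exact ⟨Or.inl h.1, h.2⟩
      · exact ⟨Or.inr h, h ▸ hb'⟩
  · refine .skip ⟨hc1, hm, ?_, e4, e5, e15⟩
    rw [e6, e7]
    exact hlast hl hb'

lemma scan_spec (hG : G.IsMedian) (hadj : IsAdjLists G adj) (hW : 4 * n ^ 2 ≤ W) {v : Fin n}
    (hk : G.dist r v = k) (hlow : ∀ x, G.dist r x < k → x ∈ S)
    (hc : Ctx n k v s.reg) (hm : MemInv G adj r (labelled G r S) S s.mem) :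
    Runs W scan s (8 * n + 7) fun s' => Ctx n k v s'.reg ∧
      MemInv G adj r (labelled G r (insert v S)) S s'.mem ∧
      LastTwo (fun x => G.Adj v x ∧ G.dist r x < k) (s'.reg 6) (s'.reg 7) := by
  have hn : n ≤ n ^ 2 := Nat.le_self_pow two_ne_zero n
  have hv := v.2
  have hkn := hG.1.dist_lt r v
  have hU : labelled G r S ∪ {x | x ∈ (adj v).take (adj v).length} =
      labelled G r (insert v S) := by
    ext x
    simp only [labelled, List.take_length, Set.mem_union, Set.mem_ofPred_eq, (hadj v).2,
      Set.exists_mem_insert]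
    generalize (∃ y ∈ S, G.Adj y x) = A
    tauto
  refine .load (.op (v + 1) ?_ (by omega) (.load (.copy (.copy (.op (k + 2) ?_ (by omega)
    (.last (.mono (.loop_const (fun j s' => Ctx n k v s'.reg ∧
      MemInv G adj r (labelled G r S ∪ {x | x ∈ (adj v).take j}) S s'.mem ∧
      LastTwo (fun x => x ∈ (adj v).take j ∧ G.dist r x < k) (s'.reg 6) (s'.reg 7) ∧
      s'.reg 4 = (inputState adj).mem 0 v + j ∧
      s'.reg 5 = (inputState adj).mem 0 v + (adj v).length ∧ s'.reg 15 = k + 2)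
      (adj v).length 7 ?_ ?_ ?_) ?_ ?_)))))))
  · simp [hc.vertex, hc.one, BinOp.eval]
  · simp [hc.label, hc.one, BinOp.eval]
  · rintro j hj s' ⟨hc', hm', hl', h4', h5', h15'⟩
    refine ⟨?_, scanBody_spec hG hadj hW hk hlow hj hc' hm' hl' h4' h5' h15'⟩
    simp only [Test.Holds, h4', h5']
    omega
  · rintro s' ⟨hc', hm', hl', h4', h5', h15'⟩
    simp only [Test.Holds, h4', h5']
    omega
  · refine ⟨?_, ?_, ?_, ?_, ?_, ?_⟩
    · repeat' refine Ctx.setReg ?_ (by simp)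
      exact hc
    · simpa using hm
    · exact Or.inl (by simp [hc.n])
    · simp [hc.vertex, hm.offset]
    · simp [hm.offset, inputState_offset_succ]
    · simp
  · have := length_adj_le hadj v
    omega
  · rintro s' ⟨hc', hm', hl', -⟩
    rw [hU] at hm'
    refine ⟨hc', hm', ?_⟩
    simpa [(hadj v).2] using hl'

end RAM

/-! ### The fourth corner of the square, and the new row and column -/

namespace RAM

variable {n : ℕ} {G : SimpleGraph (Fin n)} {adj : Fin n → List (Fin n)} {r : Fin n}
  {U S : Set (Fin n)} {W k : ℕ} {s : State}

/-- The common neighbours of `p` and `q` among the vertices in `S` that satisfy `C` are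
represented by one of them, in register `8`. -/
def Found (G : SimpleGraph (Fin n)) (S : Set (Fin n)) (C : Fin n → Prop) (p q w : ℕ) : Prop :=
  ∀ a ∈ S, ∀ b ∈ S, p = a → q = b → (∃ c ∈ S, C c ∧ G.Adj a c ∧ G.Adj b c) →
    ∃ c ∈ S, w = c ∧ G.Adj a c ∧ G.Adj b c

/-- By `hpS`, the entry `p` is a processed vertex as soon as some vertex is processed; only `q` may
be missing. -/
lemma searchBody_spec (hW : 4 * n ^ 2 ≤ W) {v : ℕ} {p q j : ℕ} (hp : p ≤ n) (hq : q ≤ n)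
    (hpS : ∀ u ∈ S, ∃ a ∈ S, p = (a : Fin n)) (hj : j < n)
    (hc : Ctx n k v s.reg) (hm : MemInv G adj r U S s.mem) (h6 : s.reg 6 = p) (h7 : s.reg 7 = q)
    (h9 : s.reg 9 = j) (hw : Found G S (fun c => (c : ℕ) < j) p q (s.reg 8)) :
    Runs W searchBody s 12 fun s' => Ctx n k v s'.reg ∧ s'.mem = s.mem ∧
      s'.reg 6 = p ∧ s'.reg 7 = q ∧ s'.reg 9 = j + 1 ∧
      Found G S (fun c => (c : ℕ) < j + 1) p q (s'.reg 8) := by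
  have hpn := (cell_le hp hj.le).trans (by omega : _ ≤ W)
  have hqn := (cell_le hq hj.le).trans (by omega : _ ≤ W)
  have hn : n ≤ n ^ 2 := Nat.le_self_pow two_ne_zero n
  obtain ⟨u, rfl⟩ : ∃ u : Fin n, j = u := ⟨⟨j, hj⟩, rfl⟩
  have hmark := hm.mark u
  -- the register `8` stays correct when `u` is not a common neighbour
  have hskip : (∀ a ∈ S, ∀ b ∈ S, p = a → q = b → u ∈ S → G.Adj a u → ¬ G.Adj b u) →
      Found G S (fun c => (c : ℕ) < u + 1) p q (s.reg 8) := by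
    rintro h a ha b hb hpa hqb ⟨c, hcS, hcu, hac, hbc⟩
    refine hw a ha b hb hpa hqb ⟨c, hcS, lt_of_le_of_ne (Nat.lt_succ_iff.1 hcu) fun e => ?_, hac, hbc⟩
    obtain rfl := Fin.ext e
    exact h a ha b hb hpa hqb hcS hac hbc
  suffices H : ∀ s1 : State, s1.mem = s.mem → s1.reg 6 = p → s1.reg 7 = q → s1.reg 9 = u →
      s1.reg 8 = s.reg 8 → s1.reg 12 = s.mem 4 u → Ctx n k v s1.reg → Runs W (.cond (.eq 12 10)
      (block [.op .mul 14 6 0, .op .add 14 14 9, .load 12 2 14,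
        .cond (.eq 12 10)
          (block [.op .mul 14 7 0, .op .add 14 14 9, .load 12 2 14,
            .cond (.eq 12 10) (block [.copy 8 9]) .skip])
          .skip])
      .skip) s1 10 fun s' => Ctx n k v s'.reg ∧ s'.mem = s.mem ∧
        s'.reg 6 = p ∧ s'.reg 7 = q ∧ s'.reg 9 = u ∧
        Found G S (fun c => (c : ℕ) < u + 1) p q (s'.reg 8) by
    refine .load (.cons ((H _ (by exact rfl) (by simpa) (by simpa) (by simpa) (by simp)
      (by simp [h9]) (by exact hc.setReg (by simp))).mono le_rfl ?_))
    rintro s' ⟨hc', hm', h6', h7', h9', hw'⟩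
    refine .op (u + 1) ?_ (by omega)
      (.nil (T := 0) ⟨hc'.setReg (by simp), hm', ?_, ?_, ?_, ?_⟩)
    · rw [h9', hc'.one]
      rfl
    · simpa using h6'
    · simpa using h7'
    · simp
    · simpa using hw'
  intro s1 e e6 e7 e9 e8 e12 hc1
  refine .cond (fun hb => ?_) fun hb => .skip ⟨hc1, e, e6, e7, e9, e8 ▸ hskip ?_⟩
  swap
  · rw [Test.Holds, e12, hc1.one, hmark] at hb
    exact fun a ha b hb' _ _ hu => absurd (if_pos hu) hb
  have hu : u ∈ S := by
    rw [Test.Holds, e12, hc1.one, hmark] at hb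
    by_contra h
    rw [if_neg h] at hb
    omega
  obtain ⟨a, ha, rfl⟩ := hpS u hu
  refine .op (a * n) (by rw [e6, hc1.n]; rfl) (by omega) (.op (a * n + u)
    (by simp [e9, BinOp.eval]) hpn (.load (.last (.cond (T := 5) (fun hb => ?_) fun hb => ?_))))
  all_goals
    simp [Test.Holds, hc1.one, e] at hb
    rw [hm.known a ha u hu, SimpleGraph.dist_eq_one_iff_adj] at hb
  swap
  · refine .skip ⟨((hc1.setReg (by simp)).setReg (by simp)).setReg (by simp), e, by simpa,
      by simpa, by simpa, ?_⟩
    simp only [State.setReg_reg]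
    refine e8 ▸ hskip fun a' _ b hb' e1 e2 _ h => ?_
    exact absurd (Fin.ext e1 ▸ h) hb
  refine .op (q * n) (by simp [e7, hc1.n, BinOp.eval]) (by omega) (.op (q * n + u)
    (by simp [e9, BinOp.eval]) hqn (.load (.last (.cond (T := 1) (fun hb' => ?_) fun hb' => ?_))))
  all_goals
    -- If `q` is `n`, the cell lies outside the matrix and its content is irrelevant; the test has
    -- to be correct only when `q` is a processed vertex.
    have hb2 : ∀ b ∈ S, q = (b : Fin n) → (G.Adj b u ↔ s.mem 2 (q * n + u) = 1) := by
      rintro b hb rfl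
      rw [hm.known b hb u hu, SimpleGraph.dist_eq_one_iff_adj]
    simp [Test.Holds, hc1.one, e] at hb'
  · refine .copy (.nil (T := 0) ⟨?_, e, by simpa, by simpa, by simpa, ?_⟩)
    · repeat' refine Ctx.setReg ?_ (by simp)
      exact hc1
    · rintro a' _ b hbS e1 e2 -
      exact ⟨u, hu, by simpa using e9, Fin.ext e1 ▸ hb, (hb2 b hbS e2).2 hb'⟩
  · refine .skip ⟨?_, e, by simpa, by simpa, by simpa, ?_⟩
    · repeat' refine Ctx.setReg ?_ (by simp)
      exact hc1
    · simp only [State.setReg_reg]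
      exact e8 ▸ hskip fun a' _ b hb1 _ e2 _ _ h => hb' ((hb2 b hb1 e2).1 h)

lemma search_spec (hW : 4 * n ^ 2 ≤ W) {v : ℕ} {p q : ℕ} (hp : p ≤ n) (hq : q ≤ n)
    (hpS : ∀ u ∈ S, ∃ a ∈ S, p = (a : Fin n))
    (hc : Ctx n k v s.reg) (hm : MemInv G adj r U S s.mem) (h6 : s.reg 6 = p) (h7 : s.reg 7 = q) :
    Runs W search s (13 * n + 2) fun s' => Ctx n k v s'.reg ∧ s'.mem = s.mem ∧
      s'.reg 6 = p ∧ s'.reg 7 = q ∧ Found G S (fun _ => True) p q (s'.reg 8) := by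
  refine .const (by omega) (.last (.mono (.loop_const (fun j s' => Ctx n k v s'.reg ∧
    s'.mem = s.mem ∧ s'.reg 6 = p ∧ s'.reg 7 = q ∧ s'.reg 9 = j ∧
    Found G S (fun c => (c : ℕ) < j) p q (s'.reg 8)) n 12 ?_ ?_ ?_) (by omega) ?_))
  · rintro j hj s' ⟨hc', hm', h6', h7', h9', hw'⟩
    refine ⟨by simpa [Test.Holds, h9', hc'.n], ?_⟩
    have := searchBody_spec hW hp hq hpS hj hc' (hm' ▸ hm) h6' h7' h9' hw'
    rwa [hm'] at this
  · rintro s' ⟨hc', hm', h6', h7', h9', hw'⟩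
    simp [Test.Holds, h9', hc'.n]
  · exact ⟨hc.setReg (by simp), rfl, by simpa, by simpa, by simp,
      fun a _ b _ _ _ ⟨c, _, hc, _⟩ => absurd hc (Nat.not_lt_zero _)⟩
  · rintro s' ⟨hc', hm', h6', h7', h9', hw'⟩
    exact ⟨hc', hm', h6', h7', fun a ha b hb h1 h2 ⟨c, hcS, _, h⟩ =>
      hw' a ha b hb h1 h2 ⟨c, hcS, c.2, h⟩⟩

/-- `MemInv` holds after writing an entry that belongs to a vertex outside `S`. -/
lemma MemInv.set_dist (h : MemInv G adj r U S s.mem) {a b : Fin n} (hab : a ≠ b)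
    (hS : a ∉ S ∨ b ∉ S) (x : ℕ) : MemInv G adj r U S (s.setMem 2 (a * n + b) x).mem := by
  refine ⟨fun i => ?_, fun i => ?_, fun y => ?_, fun y => ?_, fun y hy z hz => ?_, fun y => ?_⟩
  · simpa using h.offset i
  · simpa using h.nbr i
  · simpa using h.label y
  · simpa using h.mark y
  · rw [State.setMem_mem, if_neg, h.known y hy z hz]
    rw [cell_inj z.2 b.2]
    rintro ⟨-, h1, h2⟩
    rw [Fin.val_inj] at h1 h2
    subst h1 h2
    tauto
  · rw [State.setMem_mem, if_neg, h.diag]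
    rw [cell_inj y.2 b.2]
    rintro ⟨-, h1, h2⟩
    exact hab (Fin.ext (h1 ▸ h2))

/-- The registers `6`, `7`, `8` determine the distance from `u` to `v`. -/
def Formula (G : SimpleGraph (Fin n)) (S : Set (Fin n)) (u v : Fin n) (p q w : ℕ) : Prop :=
  ∃ a ∈ S, p = (a : ℕ) ∧ ((q = n ∧ G.dist u v = G.dist a u + 1) ∨ ∃ b ∈ S, ∃ c ∈ S,
    q = (b : ℕ) ∧ w = (c : ℕ) ∧ G.dist u v = G.dist a u + G.dist b u - G.dist c u)

lemma fillBody_spec (hG : G.Connected) (hW : 4 * n ^ 2 ≤ W) {v u : Fin n} {p q w : ℕ}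
    (hv : v ∉ S) (hf : u ∈ S → Formula G S u v p q w)
    (hc : Ctx n k v s.reg) (hm : MemInv G adj r U S s.mem) (h6 : s.reg 6 = p) (h7 : s.reg 7 = q)
    (h8 : s.reg 8 = w) (h9 : s.reg 9 = u)
    (hd : ∀ x ∈ S, x < u → s.mem 2 (v * n + x) = G.dist x v ∧ s.mem 2 (x * n + v) = G.dist x v) :
    Runs W fillBody s 21 fun s' => Ctx n k v s'.reg ∧ MemInv G adj r U S s'.mem ∧
      s'.reg 6 = p ∧ s'.reg 7 = q ∧ s'.reg 8 = w ∧ s'.reg 9 = u + 1 ∧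
      ∀ x ∈ S, x ≤ u → s'.mem 2 (v * n + x) = G.dist x v ∧
        s'.mem 2 (x * n + v) = G.dist x v := by
  have hn : n ≤ n ^ 2 := Nat.le_self_pow two_ne_zero n
  have hcell (a b : Fin n) : a * n + b ≤ W := (cell_le a.2.le b.2.le).trans (by omega)
  have hmul (a b : Fin n) : a * n ≤ W := (Nat.le_add_right _ _).trans (hcell a b)
  have hmark := hm.mark u
  suffices H : ∀ s1 : State, s1.mem = s.mem → s1.reg 6 = p → s1.reg 7 = q → s1.reg 9 = u →
      s1.reg 8 = w → s1.reg 12 = s.mem 4 u → Ctx n k v s1.reg → Runs W (.cond (.eq 12 10)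
      (block [.op .mul 14 6 0, .op .add 14 14 9, .load 12 2 14,
        .cond (.lt 7 0)
          (block [.op .mul 14 7 0, .op .add 14 14 9, .load 13 2 14, .op .add 12 12 13,
            .op .mul 14 8 0, .op .add 14 14 9, .load 13 2 14, .op .sub 12 12 13])
          (block [.op .add 12 12 10]),
        .op .mul 14 3 0, .op .add 14 14 9, .store 2 14 12,
        .op .mul 14 9 0, .op .add 14 14 3, .store 2 14 12])
      .skip) s1 19 fun s' => Ctx n k v s'.reg ∧ MemInv G adj r U S s'.mem ∧
        s'.reg 6 = p ∧ s'.reg 7 = q ∧ s'.reg 8 = w ∧ s'.reg 9 = u ∧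
        ∀ x ∈ S, x ≤ u → s'.mem 2 (v * n + x) = G.dist x v ∧
          s'.mem 2 (x * n + v) = G.dist x v by
    refine .load (.cons ((H _ (by exact rfl) (by simpa) (by simpa) (by simpa) (by simpa)
      (by simp [h9]) (by exact hc.setReg (by simp))).mono le_rfl ?_))
    rintro s' ⟨hc', hm', h6', h7', h8', h9', hd'⟩
    refine .op (u + 1) ?_ (by omega)
      (.nil (T := 0) ⟨hc'.setReg (by simp), hm', ?_, ?_, ?_, ?_, hd'⟩)
    · rw [h9', hc'.one]
      rfl
    · simpa using h6'
    · simpa using h7'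
    · simpa using h8'
    · simp
  intro s1 e e6 e7 e9 e8 e12 hc1
  by_cases hu : u ∈ S
  swap
  · refine .cond (fun hb => ?_) fun hb => .skip ⟨hc1, e ▸ hm, e6, e7, e8, e9, fun x hx hxu => ?_⟩
    · rw [Test.Holds, e12, hc1.one, hmark, if_neg hu] at hb
      omega
    · rw [e]
      exact hd x hx (lt_of_le_of_ne hxu fun h => hu (h ▸ hx))
  have huv : u ≠ v := fun h => hv (h ▸ hu)
  refine .cond (fun hb => ?_) fun hb => ?_
  swap
  · rw [Test.Holds, e12, hc1.one, hmark, if_pos hu] at hb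
    omega
  obtain ⟨a, ha, rfl, hq⟩ := hf hu
  have hau := hG.dist_lt a u
  suffices H : ∀ s2 : State, s2.mem = s.mem → s2.reg 6 = a → s2.reg 7 = q → s2.reg 9 = u →
      s2.reg 8 = w → s2.reg 12 = G.dist a u → Ctx n k v s2.reg → Runs W (.cond (.lt 7 0)
          (block [.op .mul 14 7 0, .op .add 14 14 9, .load 13 2 14, .op .add 12 12 13,
            .op .mul 14 8 0, .op .add 14 14 9, .load 13 2 14, .op .sub 12 12 13])
          (block [.op .add 12 12 10])) s2 9 fun s' => Ctx n k v s'.reg ∧ s'.mem = s.mem ∧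
        s'.reg 6 = a ∧ s'.reg 7 = q ∧ s'.reg 8 = w ∧ s'.reg 9 = u ∧
        s'.reg 12 = G.dist u v by
    refine .op (a * n) (by rw [e6, hc1.n]; rfl) (hmul a u) (.op (a * n + u)
      (by simp [e9, BinOp.eval]) (hcell a u) (.load (.cons ((H _ (by exact e) (by simpa) (by simpa)
        (by simpa) (by simpa) (by simp [e, hm.known a ha u hu]) ?_).mono le_rfl ?_))))
    · repeat' refine Ctx.setReg ?_ (by simp)
      exact hc1
    rintro s' ⟨hc', hm', h6', h7', h8', h9', h12'⟩
    -- Computing the distance has not touched the memory, so the invariants carry over to the state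
    -- before the two stores.
    rw [← hm'] at hm hd
    refine .op (v * n) (by rw [hc'.vertex, hc'.n]; rfl) (hmul v u) (.op (v * n + u)
      (by simp [h9', BinOp.eval]) (hcell v u) (.store (.op (u * n)
      (by simp [h9', hc'.n, BinOp.eval]) (hmul u v) (.op (u * n + v)
      (by simp [hc'.vertex, BinOp.eval]) (hcell u v) (.store (.nil (T := 0)
        ⟨?_, ?_, ?_, ?_, ?_, ?_, ?_⟩))))))
    · simp only [State.setMem_reg]
      refine Ctx.setReg (Ctx.setReg ?_ (by simp)) (by simp)
      simp only [State.setMem_reg]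
      exact (hc'.setReg (by simp)).setReg (by simp)
    · simp only [State.setReg_reg, State.setMem_reg, if_true]
      refine MemInv.set_dist ?_ huv (Or.inr hv) _
      simp only [State.setReg_mem]
      exact MemInv.set_dist hm huv.symm (Or.inl hv) _
    · simpa using h6'
    · simpa using h7'
    · simpa using h8'
    · simpa using h9'
    · intro x hx hxu
      have hxv : x ≠ v := fun h => hv (h ▸ hx)
      have hd' := hd x hx
      simp only [State.setMem_mem, State.setReg_mem, State.setReg_reg, State.setMem_reg, if_true,
        true_and, cell_inj, Fin.is_lt, Fin.val_inj]
      by_cases hxu' : x = u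
      · simp [hxu', huv, huv.symm, h12']
      -- For `x` other than `u`, both entries lie outside the two cells just written.
      · simpa [hxu', hxv, hxv.symm, huv.symm] using hd' (lt_of_le_of_ne hxu hxu')
  intro s2 e e6 e7 e9 e8 e12 hc2
  rcases hq with ⟨rfl, hq⟩ | ⟨b, hbS, c, hcS, rfl, rfl, hq⟩
  · refine .cond (fun hb => ?_) fun hb => ?_
    · rw [Test.Holds, e7, hc2.n] at hb
      omega
    · exact .op (G.dist u v) (by rw [e12, hc2.one, hq]; rfl) (by omega)
        (.nil (T := 7) ⟨hc2.setReg (by simp), e, by simpa, by simpa, by simpa, by simpa, by simp⟩)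
  · have hbu := hG.dist_lt b u
    have huv' := hG.dist_lt u v
    refine .cond (fun hb => ?_) fun hb => ?_
    · refine .op (b * n) (by rw [e7, hc2.n]; rfl) (hmul b u) (.op (b * n + u)
        (by simp [e9, BinOp.eval]) (hcell b u) (.load (.op (G.dist a u + G.dist b u)
        (by simp [e12, e, hm.known b hbS u hu, BinOp.eval]) (by omega) (.op (c * n)
        (by simp [e8, hc2.n, BinOp.eval]) (hmul c u) (.op (c * n + u) (by simp [e9, BinOp.eval])
        (hcell c u) (.load (.op (G.dist u v)
        (by simp [e, hm.known c hcS u hu, hq, BinOp.eval]) (by omega)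
        (.nil (T := 0) ⟨?_, by exact e, by simpa, by simpa, by simpa, by simpa, by simp⟩))))))))
      repeat' refine Ctx.setReg ?_ (by simp)
      exact hc2
    · rw [Test.Holds, e7, hc2.n] at hb
      exact absurd b.2 hb

lemma fill_spec (hG : G.Connected) (hW : 4 * n ^ 2 ≤ W) {v : Fin n} {p q w : ℕ}
    (hv : v ∉ S) (hf : ∀ u ∈ S, Formula G S u v p q w)
    (hc : Ctx n k v s.reg) (hm : MemInv G adj r U S s.mem) (h6 : s.reg 6 = p) (h7 : s.reg 7 = q)
    (h8 : s.reg 8 = w) :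
    Runs W fill s (22 * n + 2) fun s' => Ctx n k v s'.reg ∧ MemInv G adj r U S s'.mem ∧
      ∀ x ∈ S, s'.mem 2 (v * n + x) = G.dist x v ∧ s'.mem 2 (x * n + v) = G.dist x v := by
  refine .const (by omega) (.last (.mono (.loop_const (fun j s' => Ctx n k v s'.reg ∧
    MemInv G adj r U S s'.mem ∧ s'.reg 6 = p ∧ s'.reg 7 = q ∧ s'.reg 8 = w ∧ s'.reg 9 = j ∧
    ∀ x ∈ S, (x : ℕ) < j → s'.mem 2 (v * n + x) = G.dist x v ∧
      s'.mem 2 (x * n + v) = G.dist x v) n 21 ?_ ?_ ?_) (by omega) ?_))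
  · rintro j hj s' ⟨hc', hm', h6', h7', h8', h9', hd'⟩
    refine ⟨by simpa [Test.Holds, h9', hc'.n], ?_⟩
    refine (fillBody_spec (u := ⟨j, hj⟩) hG hW hv (hf _) hc' hm' h6' h7' h8' h9' hd').mono le_rfl ?_
    rintro s'' ⟨h1, h2, h3, h4, h5, h6, h7⟩
    exact ⟨h1, h2, h3, h4, h5, h6, fun x hx hxj => h7 x hx (Nat.lt_succ_iff.1 hxj)⟩
  · rintro s' ⟨hc', hm', h6', h7', h8', h9', hd'⟩
    simp [Test.Holds, h9', hc'.n]
  · exact ⟨hc.setReg (by simp), hm, by simpa, by simpa, by simpa, by simp,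
      fun x _ h => absurd h (Nat.not_lt_zero _)⟩
  · rintro s' ⟨hc', hm', -, -, -, -, hd'⟩
    exact ⟨hc', hm', fun x hx => hd' x hx x.2⟩

end RAM

/-! ### Processing a vertex, passing through the levels, and the total cost -/

namespace RAM

variable {n : ℕ} {G : SimpleGraph (Fin n)} {adj : Fin n → List (Fin n)} {r : Fin n}
  {S : Set (Fin n)} {W k : ℕ} {s : State}

lemma eq_root_of_lastTwo (hG : G.Connected) {v : Fin n} {C : Fin n → Prop}
    (hC : ∀ x, C x ↔ G.Adj v x ∧ G.dist r x < G.dist r v) (h : ∀ y, ¬ C y) : v = r := by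
  by_contra hvr
  obtain ⟨z, hz, hd⟩ := hG.exists_adj_dist_succ hvr
  rw [SimpleGraph.dist_comm, SimpleGraph.dist_comm (u := v)] at hd
  exact h z ((hC z).2 ⟨hz, by omega⟩)

lemma formula_of_found (hG : G.IsMedian) {v : Fin n} (hk : G.dist r v = k) (hv : v ∉ S)
    (hlow : ∀ x, G.dist r x < k → x ∈ S) (hup : ∀ x ∈ S, G.dist r x ≤ k) {p q w : ℕ}
    (hl : LastTwo (fun x => G.Adj v x ∧ G.dist r x < k) p q)
    (hw : Found G S (fun _ => True) p q w) {u : Fin n} (hu : u ∈ S) : Formula G S u v p q w := by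
  subst hk
  have huv : u ≠ v := fun h => hv (h ▸ hu)
  have hul := hup u hu
  rcases hl with ⟨-, -, h⟩ | ⟨a, ⟨hva, ha⟩, rfl, rfl, h⟩ |
    ⟨a, b, hab, ⟨hva, ha⟩, ⟨hvb, hb⟩, rfl, rfl⟩
  -- Without lower neighbours `v` is the root, and a processed `u` at distance at most zero would be
  -- `v` itself.
  · obtain rfl := eq_root_of_lastTwo hG.1 (fun _ => Iff.rfl) h
    rw [SimpleGraph.dist_self, Nat.le_zero, hG.1.dist_eq_zero_iff] at hul
    exact absurd hul.symm huv
  · refine ⟨a, hlow a ha, rfl, Or.inl ⟨rfl, ?_⟩⟩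
    rw [hG.dist_eq_dist_add_one (fun y h1 h2 => h y ⟨h1, h2⟩) hva huv hul, SimpleGraph.dist_comm]
  · have ha' := hG.dist_succ_or hva r
    have hb' := hG.dist_succ_or hvb r
    obtain ⟨c, hac, hbc, hc⟩ := hG.quadrangle (u := r) hva hvb hab (by omega) (by omega)
    -- The search may return a common neighbour different from the one given by the quadrangle
    -- condition. Any one in `S` will do, because it differs from `v` and thus completes a square.
    obtain ⟨c, hcS, rfl, hac, hbc⟩ := hw a (hlow a ha) b (hlow b hb) rfl rfl
      ⟨c, hlow c (by omega), trivial, hac, hbc⟩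
    refine ⟨a, hlow a ha, rfl, Or.inr ⟨b, hlow b hb, c, hcS, rfl, rfl, ?_⟩⟩
    have hvc : v ≠ c := fun h => hv (h ▸ hcS)
    have := hG.dist_add_dist_of_square hvc hab hva hvb hac.symm hbc.symm u
    rw [SimpleGraph.dist_comm (u := a), SimpleGraph.dist_comm (u := b),
      SimpleGraph.dist_comm (u := c)]
    omega

lemma process_spec (hG : G.IsMedian) (hadj : IsAdjLists G adj) (hW : 4 * n ^ 2 ≤ W) {v : Fin n}
    (hk : G.dist r v = k) (hv : v ∉ S) (hlow : ∀ x, G.dist r x < k → x ∈ S)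
    (hup : ∀ x ∈ S, G.dist r x ≤ k)
    (hc : Ctx n k v s.reg) (hm : MemInv G adj r (labelled G r S) S s.mem) :
    Runs W process s (43 * n + 12) fun s' => Ctx n k v s'.reg ∧
      MemInv G adj r (labelled G r (insert v S)) (insert v S) s'.mem := by
  refine .mono (T := 1 + (22 * n + 2) + (13 * n + 2) + (8 * n + 7))
    (.cons ((scan_spec hG hadj hW hk hlow hc hm).mono le_rfl ?_)) (by omega) fun _ h => h
  rintro s1 ⟨hc1, hm1, hl⟩
  have hpS : ∀ u ∈ S, ∃ a ∈ S, s1.reg 6 = (a : Fin n) := by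
    intro u hu
    rcases hl with ⟨-, -, h⟩ | ⟨a, ⟨-, ha⟩, h, -⟩ | ⟨a, -, -, ⟨-, ha⟩, -, h, -⟩
    · subst hk
      obtain rfl := eq_root_of_lastTwo hG.1 (fun _ => Iff.rfl) h
      have := hup u hu
      rw [SimpleGraph.dist_self, Nat.le_zero, hG.1.dist_eq_zero_iff] at this
      exact absurd (this ▸ hu) hv
    · exact ⟨a, hlow a ha, h⟩
    · exact ⟨a, hlow a ha, h⟩
  refine .cons ((search_spec hW hl.le.1 hl.le.2 hpS hc1 hm1 rfl rfl).mono le_rfl ?_)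
  rintro s2 ⟨hc2, hm2, h6, h7, hw⟩
  rw [← hm2] at hm1
  refine .cons ((fill_spec hG.1 hW hv
    (fun u hu => formula_of_found hG hk hv hlow hup hl hw hu) hc2 hm1 h6 h7 rfl).mono le_rfl ?_)
  rintro s3 ⟨hc3, hm3, hd⟩
  refine .store (.nil (T := 0) ⟨hc3, ?_⟩)
  rw [hc3.vertex, hc3.one]
  refine ⟨fun i => ?_, fun i => ?_, fun x => ?_, fun x => ?_, fun x hx y hy => ?_, fun x => ?_⟩
  · simpa using hm3.offset i
  · simpa using hm3.nbr i
  · simpa using hm3.label x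
  · have := hm3.mark x
    rw [State.setMem_mem]
    by_cases hxv : x = v
    · rw [if_pos ⟨rfl, hxv ▸ rfl⟩, if_pos (hxv ▸ Set.mem_insert _ _)]
    · rw [if_neg fun h => hxv (Fin.ext h.2), this]
      by_cases hx : x ∈ S
      · rw [if_pos hx, if_pos (Set.mem_insert_of_mem _ hx)]
      · rw [if_neg hx, if_neg fun h => h.elim hxv hx]
  · rw [State.setMem_mem, if_neg (by simp)]
    rcases hx with rfl | hx <;> rcases hy with rfl | hy
    -- The diagonal is never written and keeps its initial zeros.
    · rw [hm3.diag, SimpleGraph.dist_self]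
    · rw [(hd y hy).1, SimpleGraph.dist_comm]
    · rw [(hd x hx).2]
    · exact hm3.known x hx y hy
  · simpa using hm3.diag x

/-- The vertices processed before the vertex `j` of level `k`. -/
def processed (G : SimpleGraph (Fin n)) (r : Fin n) (k j : ℕ) : Set (Fin n) :=
  {x | G.dist r x < k ∨ G.dist r x = k ∧ (x : ℕ) < j}

/-- The neighbour of `v` on the way to the root is on a level below `k`, hence processed. Thus level
`k` is fully labelled before its first vertex is treated. -/
lemma mem_labelled_processed (hG : G.Connected) {v : Fin n} {j : ℕ} (hv : G.dist r v ≤ k) :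
    v ∈ labelled G r (processed G r k j) := by
  by_cases hvr : v = r
  · exact Or.inl hvr
  · obtain ⟨z, hz, hd⟩ := hG.exists_adj_dist_succ hvr
    rw [SimpleGraph.dist_comm, SimpleGraph.dist_comm (u := v)] at hd
    exact Or.inr ⟨z, Or.inl (by omega), hz.symm⟩

/-- The cost of processing the vertices, as a function of the level `k` and the vertex `j`. -/
noncomputable def levelCost (G : SimpleGraph (Fin n)) (r : Fin n) (k j : ℕ) : ℕ :=
  if h : j < n then if G.dist r ⟨j, h⟩ = k then 43 * n + 12 else 0 else 0

/-- After exchanging the sums, each vertex is charged on one level only, that of its distance from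
the root. -/
lemma sum_levelCost_le (G : SimpleGraph (Fin n)) (r : Fin n) :
    ∑ k ∈ Finset.range n, ∑ j ∈ Finset.range n, levelCost G r k j ≤ n * (43 * n + 12) := by
  rw [Finset.sum_comm]
  refine (Finset.sum_le_card_nsmul _ _ (43 * n + 12) fun j hj => ?_).trans (by simp)
  simp only [levelCost, Finset.mem_range.1 hj, dif_pos]
  rw [Finset.sum_ite_eq]
  split_ifs <;> omega

lemma vertexBody_spec (hG : G.IsMedian) (hadj : IsAdjLists G adj) (hW : 4 * n ^ 2 ≤ W) {j : ℕ}
    (hj : j < n) (hc : Ctx n k j s.reg)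
    (hm : MemInv G adj r (labelled G r (processed G r k j)) (processed G r k j) s.mem) :
    Runs W vertexBody s (levelCost G r k j + 3) fun s' => Ctx n k (j + 1) s'.reg ∧
      MemInv G adj r (labelled G r (processed G r k (j + 1))) (processed G r k (j + 1)) s'.mem := by
  have hn : n ≤ n ^ 2 := Nat.le_self_pow two_ne_zero n
  obtain ⟨v, rfl⟩ : ∃ v : Fin n, j = v := ⟨⟨j, hj⟩, rfl⟩
  have hcost : levelCost G r k v = if G.dist r v = k then 43 * n + 12 else 0 := by
    simp [levelCost]
  -- The label `0` of an unseen vertex never equals `k + 1`, and no vertex of level `k` is unseen.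
  have hlabel : s.mem 3 v = k + 1 ↔ G.dist r v = k := by
    rw [hm.label v]
    constructor
    · intro h
      split_ifs at h
      omega
    · intro h
      rw [if_pos (mem_labelled_processed hG.1 h.le), h]
  have hc1 : Ctx n k v (s.setReg 12 (s.mem 3 (s.reg 3))).reg := hc.setReg (by simp)
  refine .mono (T := 1 + (levelCost G r k v + 1) + 1) (.load (.cons (.mono (Q := fun s' =>
    Ctx n k v s'.reg ∧ MemInv G adj r (labelled G r (processed G r k (v + 1)))
      (processed G r k (v + 1)) s'.mem) (.cond (fun hb => ?_) fun hb => ?_) le_rfl ?_)))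
    (by omega) fun _ h => h
  · have hk : G.dist r v = k := by
      rw [Test.Holds, hc1.label] at hb
      simpa [hc.vertex, hlabel] using hb
    have e : processed G r k (v + 1) = insert v (processed G r k v) := by
      ext x
      simp only [processed, Set.mem_insert_iff, Set.mem_ofPred_eq, Nat.lt_succ_iff_lt_or_eq,
        Fin.val_inj]
      constructor
      · tauto
      · rintro (rfl | h) <;> tauto
    rw [e, hcost, if_pos hk]
    refine process_spec hG hadj hW hk ?_ (fun x hx => Or.inl hx) ?_ hc1 hm
    · rintro (h | h) <;> omega
    · rintro x (h | h) <;> omega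
  · have hk : G.dist r v ≠ k := by
      rw [Test.Holds, hc1.label] at hb
      simpa [hc.vertex, hlabel] using hb
    have e : processed G r k (v + 1) = processed G r k v := by
      ext x
      simp only [processed, Set.mem_ofPred_eq, Nat.lt_succ_iff_lt_or_eq, Fin.val_inj]
      constructor
      · rintro (h | ⟨h, h' | rfl⟩)
        · exact Or.inl h
        · exact Or.inr ⟨h, h'⟩
        · exact absurd h hk
      · tauto
    rw [e]
    exact .skip ⟨hc1, hm⟩
  · rintro s' ⟨hc', hm'⟩
    refine .op (v + 1) (by rw [hc'.vertex, hc'.one]; rfl) (by omega) (.nil (T := 0) ⟨?_, hm'⟩)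
    obtain ⟨h1, h2, h3, h4, h5, h6⟩ := hc'
    constructor <;> simp [*]

lemma levelBody_spec (hG : G.IsMedian) (hadj : IsAdjLists G adj) (hW : 4 * n ^ 2 ≤ W)
    (hk : k < n) (h0 : s.reg 0 = n) (h1 : s.reg 1 = k) (h10 : s.reg 10 = 1) (h11 : s.reg 11 = 0)
    (hm : MemInv G adj r (labelled G r (processed G r k 0)) (processed G r k 0) s.mem) :
    Runs W levelBody s (∑ j ∈ Finset.range n, levelCost G r k j + (4 * n + 4)) fun s' =>
      s'.reg 0 = n ∧ s'.reg 1 = k + 1 ∧ s'.reg 10 = 1 ∧ s'.reg 11 = 0 ∧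
      MemInv G adj r (labelled G r (processed G r (k + 1) 0)) (processed G r (k + 1) 0) s'.mem := by
  have hn : n ≤ n ^ 2 := Nat.le_self_pow two_ne_zero n
  refine .mono (T := 1 + (∑ j ∈ Finset.range n, (levelCost G r k j + 3 + 1) + 1) + 1 + 1)
    (.op (k + 1) (by rw [h1, h10]; rfl) (by omega) (.const (by omega) (.cons (.mono (.loop
      (fun j s' => Ctx n k j s'.reg ∧ MemInv G adj r (labelled G r (processed G r k j))
        (processed G r k j) s'.mem) n _ ?_ ?_ ?_) le_rfl ?_)))) ?_ fun _ h => h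
  · rintro j hj s' ⟨hc', hm'⟩
    exact ⟨by simpa [Test.Holds, hc'.vertex, hc'.n], vertexBody_spec hG hadj hW hj hc' hm'⟩
  · rintro s' ⟨hc', hm'⟩
    simp [Test.Holds, hc'.vertex, hc'.n]
  · refine ⟨?_, hm⟩
    constructor <;> simp [*]
  · rintro s' ⟨hc', hm'⟩
    have e : processed G r (k + 1) 0 = processed G r k n := by
      ext x
      simp only [processed, Set.mem_ofPred_eq, Nat.lt_succ_iff_lt_or_eq, Fin.is_lt, and_true,
        Nat.not_lt_zero, and_false, or_false]
    rw [e]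
    refine .op (k + 1) (by rw [hc'.level, hc'.one]; rfl) (by omega)
      (.nil (T := 0) ⟨?_, ?_, ?_, ?_, hm'⟩)
    · simpa using hc'.n
    · simp
    · simpa using hc'.one
    · simpa using hc'.zero
  · simp only [Finset.sum_add_distrib, Finset.sum_const, Finset.card_range, smul_eq_mul]
    omega

lemma distanceProg_spec (hG : G.IsMedian) (hadj : IsAdjLists G adj) (hW : 4 * n ^ 2 ≤ W) :
    Runs W distanceProg (inputState adj) (100 * n ^ 2) (HoldsDistanceMatrix G) := by
  have hn : n ≤ n ^ 2 := Nat.le_self_pow two_ne_zero n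
  have hpos : 0 < n := (hG.1.nonempty.some).pos
  let r : Fin n := ⟨0, hpos⟩
  refine .mono (.const (by omega) (.store (.last (.loop (fun k s' => s'.reg 0 = n ∧
    s'.reg 1 = k ∧ s'.reg 10 = 1 ∧ s'.reg 11 = 0 ∧ MemInv G adj r
      (labelled G r (processed G r k 0)) (processed G r k 0) s'.mem) n
    (fun k => ∑ j ∈ Finset.range n, levelCost G r k j + (4 * n + 4)) ?_ ?_ ?_)))) ?_ ?_
  · rintro k hk s' ⟨h0, h1, h10, h11, hm⟩
    exact ⟨by simpa [Test.Holds, h0, h1], levelBody_spec hG hadj hW hk h0 h1 h10 h11 hm⟩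
  · rintro s' ⟨h0, h1, -⟩
    simp [Test.Holds, h0, h1]
  · have e : processed G r 0 0 = ∅ := by
      ext x
      simp [processed]
    rw [e]
    refine ⟨by simp [inputState], by simp [inputState], by simp, by simp [inputState],
      fun i => by simp, fun i => by simp, fun x => ?_, fun x => ?_, fun x hx => absurd hx (by simp),
      fun x => by simp [inputState]⟩
    · by_cases hx : x = r
      · subst hx
        simp [labelled, inputState, r]
      · have hx0 : (x : ℕ) ≠ 0 := fun h => hx (Fin.ext h)
        simp [labelled, inputState, hx, hx0]
    · simp [inputState]
  · simp only [Finset.sum_add_distrib, Finset.sum_const, Finset.card_range, smul_eq_mul]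
    have := sum_levelCost_le G r
    nlinarith
  · rintro s' ⟨-, -, -, -, hm⟩ u v
    -- All distances from the root are below `n`, so after `n` levels every vertex is processed.
    exact hm.known u (Or.inl (hG.1.dist_lt r u)) v (Or.inl (hG.1.dist_lt r v))

end RAM

/-- One program computes the distance matrix of every median graph in `O(n²)` steps with words of
`O(log n)` bits, and every computation of this matrix takes at least `n² - n` steps. -/
theorem proposition5p6 :
    (∃ (P : RAM.Prog) (C k : ℕ), ∀ (n : ℕ) (G : SimpleGraph (Fin n)), G.IsMedian →
      ∀ adj : Fin n → List (Fin n), RAM.IsAdjLists G adj →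
        (RAM.inputState adj).Fits (C * n ^ k) ∧
        ∃ (t : ℕ) (s : RAM.State),
          RAM.Exec (C * n ^ k) P (RAM.inputState adj) t s ∧
          RAM.HoldsDistanceMatrix G s ∧ t ≤ C * n ^ 2) ∧
    (∀ (P : RAM.Prog) (W n : ℕ) (G : SimpleGraph (Fin n)), G.IsMedian →
      ∀ adj : Fin n → List (Fin n), RAM.IsAdjLists G adj →
        ∀ (t : ℕ) (s : RAM.State),
          RAM.Exec W P (RAM.inputState adj) t s →
          RAM.HoldsDistanceMatrix G s → n ^ 2 ≤ t + n) := by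
  -- The bound `100 * n ^ 2` serves for both time and words; for the words `4 * n ^ 2` is enough.
  refine ⟨⟨RAM.distanceProg, 100, 2, fun n G hG adj hadj => ?_⟩,
    fun P W n G hG adj hadj t s h hs => RAM.sq_le_add_of_exec hG.1 h hs⟩
  have hW : 4 * n ^ 2 ≤ 100 * n ^ 2 := by omega
  obtain ⟨t, s, h1, h2, h3⟩ := RAM.distanceProg_spec hG hadj hW
  exact ⟨RAM.fits_inputState hadj hW, t, s, h1, h3, h2⟩
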